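/- Let $\mathbb{P}=\{1,2,3,\ldots\}$ and let $\mathbb{P}^*$ be the set of finite words over $\mathbb{P}$. Two words differ by a Knuth transposition if, for some words $x,y$ and letters $a,b,c\in\mathbb{P}$, they are $xacby$ and $xcaby$ with $a\le b<c$, or $xbacy$ and $xbcay$ with $a<b\le c$. Two words are Knuth-equivalent, written $v\equiv w$, if one is obtained from the other by a finite sequence of Knuth transpositions. For $u\in\mathbb{P}^*$ let $$C(u)=\{w\in\mathbb{P}^* \mid uw\equiv wu\}$$ be the centralizer of $u$ in the plactic monoid. For $w\in\mathbb{P}^*$ let $P(w)$ be the insertion tableau of $w$ under the Robinson-Schensted-Knuth correspondence (row insertion of the letters of $w$ from left to right, where an inserted letter bumps the leftmost strictly larger entry of a row), and let $R_1,R_2,\ldots$ be its rows from top to bottom, with $R_i$ empty below the last row. Theorem. For all positive integers $a$ and $k$, let $a^k$ be the word consisting of $k$ letters $a$. Then $$C(a^k)=C(a).$$ In particular $C(a^k)$ does not depend on $k$. Moreover, for every word $w\in\mathbb{P}^*$ the following are equivalent: 1. $w\in C(a^k)$; 2. every entry of $R_1$ is at most $a$, and for every $i\ge 1$ the number of entries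 of $R_i$ that are smaller than $a$ equals the number of entries of $R_{i+1}$ that are at most $a$ (entries counted with multiplicity); 3. every column of $P(w)$ contains an entry equal to $a$. -/

import Mathlib

namespace Plactic

/-- Words over the positive integers; concatenation of words is `++`. -/
abbrev Word : Type := List ℕ+

/-- `KnuthStep v w`: the words `v` and `w` differ by an elementary Knuth transposition, read from
left to right (`Relation.EqvGen` below also allows the opposite direction). -/
inductive KnuthStep : Word → Word → Prop
  | acb (x y : Word) (a b c : ℕ+) (hab : a ≤ b) (hbc : b < c) :
      KnuthStep (x ++ [a, c, b] ++ y) (x ++ [c, a, b] ++ y)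
  | bac (x y : Word) (a b c : ℕ+) (hab : a < b) (hbc : b ≤ c) :
      KnuthStep (x ++ [b, a, c] ++ y) (x ++ [b, c, a] ++ y)

/-- Knuth equivalence: one word is obtained from the other by finitely many Knuth transpositions,
each used in either direction. -/
def KnuthEquiv (v w : Word) : Prop := Relation.EqvGen KnuthStep v w

/-- The centralizer `C(u)` of `u` in the plactic monoid, as a set of words. -/
def centralizer (u : Word) : Set Word := {w | KnuthEquiv (u ++ w) (w ++ u)}

/-- A tableau, as the list of its rows from top to bottom, each read from left to right. -/
abbrev Tableau : Type := List (List ℕ+)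

/-- Insertion of `x` into a row: `x` replaces the leftmost entry that is strictly larger than `x`,
and this entry is bumped (second component); if there is none, `x` is put at the end of the row. -/
def rowInsert (x : ℕ+) : List ℕ+ → List ℕ+ × Option ℕ+
  | [] => ([x], none)
  | y :: R => if x < y then (x :: R, some y) else (y :: (rowInsert x R).1, (rowInsert x R).2)

/-- Insertion of `x` into a tableau: `x` is inserted into the first row, and a bumped entry is
inserted into the rows below. -/
def tableauInsert (x : ℕ+) : Tableau → Tableau
  | [] => [[x]]
  | R :: T =>
    match (rowInsert x R).2 with
    | none => (rowInsert x R).1 :: T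
    | some y => (rowInsert x R).1 :: tableauInsert y T

/-- The insertion tableau `P(w)`: the letters of `w` are inserted from left to right, starting
with the empty tableau. -/
def insertionTableau (w : Word) : Tableau := w.foldl (fun T x => tableauInsert x T) []

/-- The row with index `i` (the top row has index `0`); it is empty below the last row. -/
def row (T : Tableau) (i : ℕ) : List ℕ+ := T.getD i []

/-- The column with index `j` (the leftmost column has index `0`), read from top to bottom. -/
def column (T : Tableau) (j : ℕ) : List ℕ+ := T.filterMap (fun R => R[j]?)

/-- The row conditions for `a`: all entries of the first row are at most `a`, and every row has
as many entries smaller than `a` as the next row has entries at most `a`. -/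
def RowCondition (a : ℕ+) (T : Tableau) : Prop :=
  (∀ x ∈ row T 0, x ≤ a) ∧
    ∀ i : ℕ, (row T i).countP (fun x => x < a) = (row T (i + 1)).countP (fun x => x ≤ a)

/-- The column condition for `a`: every column contains `a`. The columns are those with an index
smaller than the length of the first row. -/
def ColumnCondition (a : ℕ+) (T : Tableau) : Prop :=
  ∀ j < (row T 0).length, a ∈ column T j

end Plactic

/-! Columns suffice: `w` is Knuth-equivalent to the row word of `P(w)`, and peeling off first
columns (`IsSemistandard.knuthEquiv_rowWord`) turns that into a product of strictly decreasing
column words. A letter `a` commutes with any such word containing it (`KnuthEquiv.commute_column`),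
so if every column contains `a`, then `w` commutes with `a` and with all its powers.

Conversely, if `w` commutes with `a^k`, it commutes with some `a^n`, `n > |w|`. Only the first row
of the insertion tableau is needed as a Knuth invariant; compare it for `a^n w` and `w a^n`. In the
second word the final `a`s bump every larger entry, and the row of `a^n w` contains `R_1`, so `R_1`
has no entry above `a`. Counting entries `≤ a` gives `n + |w|_a` for the first word and `n + #{R_1 ≤
a}` for the second, so `#{R_1 ≤ a} = |w|_a`. Strict columns give `#{R_{i+1} ≤ a} ≤ #{R_i < a}`;
summing over the rows, the equality forces each of these to be an equality.

The row and column conditions agree because the equalities say that below each entry `< a` there is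
an entry `≤ a`: descending a column must meet `a`. -/

namespace Plactic

/-! ### Knuth equivalence as a congruence -/

namespace KnuthEquiv

theorem refl (v : Word) : KnuthEquiv v v := Relation.EqvGen.refl v

theorem symm {v w : Word} (h : KnuthEquiv v w) : KnuthEquiv w v := Relation.EqvGen.symm _ _ h

theorem trans {u v w : Word} (h : KnuthEquiv u v) (h' : KnuthEquiv v w) : KnuthEquiv u w :=
  Relation.EqvGen.trans _ _ _ h h'

instance : Trans KnuthEquiv KnuthEquiv KnuthEquiv := ⟨trans⟩

/-- Knuth equivalence is preserved by placing words on both sides. -/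
theorem context {v w : Word} (h : KnuthEquiv v w) (x y : Word) :
    KnuthEquiv (x ++ v ++ y) (x ++ w ++ y) := by
  induction h with
  | rel v w h =>
    refine Relation.EqvGen.rel _ _ ?_
    cases h with
    | acb x' y' a b c hab hbc =>
      simpa only [List.append_assoc] using KnuthStep.acb (x ++ x') (y' ++ y) a b c hab hbc
    | bac x' y' a b c hab hbc =>
      simpa only [List.append_assoc] using KnuthStep.bac (x ++ x') (y' ++ y) a b c hab hbc
  | refl => exact refl _
  | symm _ _ _ ih => exact ih.symm
  | trans _ _ _ _ _ ih ih' => exact ih.trans ih'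

theorem append_left {v w : Word} (h : KnuthEquiv v w) (x : Word) :
    KnuthEquiv (x ++ v) (x ++ w) := by
  simpa using h.context x []

theorem append_right {v w : Word} (h : KnuthEquiv v w) (y : Word) :
    KnuthEquiv (v ++ y) (w ++ y) := by
  simpa using h.context [] y

theorem perm {v w : Word} (h : KnuthEquiv v w) : v.Perm w := by
  induction h with
  | rel v w h =>
    cases h with
    | acb x y a b c =>
      exact ((List.Perm.swap c a [b]).append_left x).append_right y
    | bac x y a b c =>
      exact (((List.Perm.swap c a []).cons b).append_left x).append_right y
  | refl => exact List.Perm.refl _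
  | symm _ _ _ ih => exact ih.symm
  | trans _ _ _ _ _ ih ih' => exact ih.trans ih'

theorem acb {a b c : ℕ+} (hab : a ≤ b) (hbc : b < c) (y : Word) :
    KnuthEquiv (a :: c :: b :: y) (c :: a :: b :: y) :=
  Relation.EqvGen.rel _ _ (by simpa using KnuthStep.acb [] y a b c hab hbc)

theorem bac {a b c : ℕ+} (hab : a < b) (hbc : b ≤ c) (y : Word) :
    KnuthEquiv (b :: a :: c :: y) (b :: c :: a :: y) :=
  Relation.EqvGen.rel _ _ (by simpa using KnuthStep.bac [] y a b c hab hbc)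

/-- A small letter moves left through a weakly increasing word, as long as a letter between the
two stays in front. -/
theorem cons_append_singleton {x y : ℕ+} {R : Word} (hxy : x < y)
    (hR : (y :: R).Pairwise (· ≤ ·)) :
    KnuthEquiv (y :: (R ++ [x])) (y :: x :: R) := by
  induction R generalizing y with
  | nil => exact refl _
  | cons r R ih =>
    have hr : y ≤ r := List.rel_of_pairwise_cons hR (by simp)
    calc KnuthEquiv (y :: (r :: R ++ [x])) (y :: r :: x :: R) :=
          (ih (hxy.trans_le hr) (List.pairwise_cons.1 hR).2).append_left [y]
      KnuthEquiv _ (y :: x :: r :: R) := (bac hxy hr R).symm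

/-- A strictly decreasing word moves left through a weakly increasing word of larger letters. -/
theorem cons_append_decreasing {y : ℕ+} {R D : Word} (hR : (y :: R).Pairwise (· ≤ ·))
    (hD : (y :: D).Pairwise (· > ·)) :
    KnuthEquiv (y :: (R ++ D)) (y :: (D ++ R)) := by
  induction D generalizing y with
  | nil => simpa using refl _
  | cons d D ih =>
    have hd : d < y := List.rel_of_pairwise_cons hD (by simp)
    have hdR : (d :: R).Pairwise (· ≤ ·) := by
      rw [List.pairwise_cons] at hR ⊢
      exact ⟨fun z hz => hd.le.trans (hR.1 z hz), hR.2⟩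
    calc KnuthEquiv (y :: (R ++ d :: D)) (y :: d :: (R ++ D)) := by
          simpa using (cons_append_singleton hd hR).append_right D
      KnuthEquiv _ (y :: d :: (D ++ R)) :=
          (ih hdR (List.pairwise_cons.1 hD).2).append_left [y]

/-- A letter moves right through a strictly decreasing word, up to its second last letter. -/
theorem cons_decreasing_append {a : ℕ+} {D : Word} (hD : (D ++ [a]).Pairwise (· > ·)) :
    KnuthEquiv (a :: (D ++ [a])) (D ++ [a, a]) := by
  suffices h : ∀ (b : ℕ+), a ≤ b → (D ++ [b]).Pairwise (· > ·) →
      KnuthEquiv (a :: (D ++ [b])) (D ++ [a, b]) from h a le_rfl hD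
  clear hD
  intro b hab hD
  induction D with
  | nil => exact refl _
  | cons d D ih =>
    rw [List.cons_append, List.pairwise_cons] at hD
    refine trans ?_ ((ih hD.2).append_left [d])
    cases D with
    | nil => exact acb hab (hD.1 b (by simp)) []
    -- The transposition of `a` and `d` is witnessed by the next letter `e`, as `a ≤ e < d`.
    | cons e D =>
      refine acb ?_ (hD.1 e (by simp)) _
      exact hab.trans (List.rel_of_pairwise_cons hD.2 (by simp)).le

/-- A letter commutes with every column that contains it. -/
theorem commute_column {a : ℕ+} {C : Word} (hC : C.Pairwise (· > ·)) (ha : a ∈ C) :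
    KnuthEquiv (a :: C) (C ++ [a]) := by
  obtain ⟨D, E, rfl⟩ := List.append_of_mem ha
  have hE : (a :: E).Pairwise (· > ·) := (List.pairwise_append.1 hC).2.1
  have hD : (D ++ [a]).Pairwise (· > ·) :=
    hC.sublist (List.Sublist.append_left (by simp) D)
  calc KnuthEquiv (a :: (D ++ a :: E)) (D ++ a :: a :: E) := by
        simpa using (cons_decreasing_append hD).append_right E
    KnuthEquiv _ (D ++ a :: E ++ [a]) := by
        simpa using (cons_append_decreasing (R := [a]) (by simp) hE).append_left D

end KnuthEquiv

theorem append_mem_centralizer {u u' w : Word} (h : w ∈ centralizer u)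
    (h' : w ∈ centralizer u') : w ∈ centralizer (u ++ u') := by
  have h1 : KnuthEquiv (u ++ w) (w ++ u) := h
  have h2 : KnuthEquiv (u' ++ w) (w ++ u') := h'
  change KnuthEquiv _ _
  simpa using (h2.append_left u).trans (by simpa using h1.append_right u')

/-- Used to make the exponent exceed `|w|`, and to pass from `a` to `a^k`. -/
theorem mem_centralizer_replicate_mul {a : ℕ+} {k : ℕ} {w : Word}
    (h : w ∈ centralizer (List.replicate k a)) (n : ℕ) :
    w ∈ centralizer (List.replicate (n * k) a) := by
  induction n with
  | zero => simpa [centralizer] using KnuthEquiv.refl w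
  | succ n ih =>
    rw [Nat.succ_mul, List.replicate_add]
    exact append_mem_centralizer ih h

/-! ### Insertion into a row -/

theorem rowInsert_cons_of_lt {x y : ℕ+} (h : x < y) (R : List ℕ+) :
    rowInsert x (y :: R) = (x :: R, some y) := by
  simp [rowInsert, h]

theorem rowInsert_cons_of_le {x y : ℕ+} (h : y ≤ x) (R : List ℕ+) :
    rowInsert x (y :: R) = (y :: (rowInsert x R).1, (rowInsert x R).2) := by
  simp [rowInsert, not_lt.2 h]

theorem lt_of_rowInsert_eq_some {x y : ℕ+} {R : List ℕ+} (h : (rowInsert x R).2 = some y) :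
    x < y := by
  induction R with
  | nil => simp [rowInsert] at h
  | cons r R ih =>
    rcases lt_or_ge x r with hx | hx
    · rw [rowInsert_cons_of_lt hx] at h
      simp_all
    · rw [rowInsert_cons_of_le hx] at h
      exact ih h

theorem mem_rowInsert {x z : ℕ+} {R : List ℕ+} (h : z ∈ (rowInsert x R).1) :
    z = x ∨ z ∈ R := by
  induction R with
  | nil => simpa [rowInsert] using h
  | cons r R ih =>
    rcases lt_or_ge x r with hx | hx
    · rw [rowInsert_cons_of_lt hx] at h
      simp at h ⊢
      tauto
    · rw [rowInsert_cons_of_le hx] at h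
      simp at h ⊢
      tauto

theorem pairwise_rowInsert {R : List ℕ+} (h : R.Pairwise (· ≤ ·)) (x : ℕ+) :
    (rowInsert x R).1.Pairwise (· ≤ ·) := by
  induction R with
  | nil => simp [rowInsert]
  | cons r R ih =>
    rw [List.pairwise_cons] at h
    rcases lt_or_ge x r with hx | hx
    · rw [rowInsert_cons_of_lt hx, List.pairwise_cons]
      exact ⟨fun z hz => hx.le.trans (h.1 z hz), h.2⟩
    · rw [rowInsert_cons_of_le hx, List.pairwise_cons]
      refine ⟨fun z hz => ?_, ih h.2⟩
      rcases mem_rowInsert hz with rfl | hz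
      exacts [hx, h.1 z hz]

/-- Row insertion is a Knuth equivalence: the bumped letter comes out in front of the row. -/
theorem knuthEquiv_rowInsert {R : List ℕ+} (h : R.Pairwise (· ≤ ·)) (x : ℕ+) :
    KnuthEquiv (R ++ [x]) ((rowInsert x R).2.toList ++ (rowInsert x R).1) := by
  induction R with
  | nil => exact KnuthEquiv.refl _
  | cons r R ih =>
    rcases lt_or_ge x r with hx | hx
    · rw [rowInsert_cons_of_lt hx]
      exact KnuthEquiv.cons_append_singleton hx h
    · rw [rowInsert_cons_of_le hx]
      rw [List.pairwise_cons] at h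
      refine ((ih h.2).append_left [r]).trans ?_
      cases hy : (rowInsert x R).2 with
      | none => exact KnuthEquiv.refl _
      | some y =>
        have hxy := lt_of_rowInsert_eq_some hy
        -- To bring `y` in front of `r`, the witness is the head of the new row, `x` or `s`, which
        -- is at least `r` and below `y`.
        cases R with
        | nil => simp [rowInsert] at hy
        | cons s R =>
          rcases lt_or_ge x s with hs | hs
          · rw [rowInsert_cons_of_lt hs] at hy ⊢
            exact KnuthEquiv.acb hx hxy R
          · rw [rowInsert_cons_of_le hs] at hy ⊢
            exact KnuthEquiv.acb (h.1 s (by simp)) (hs.trans_lt hxy) _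

/-- If `x` bumps an entry of `S` that `R` omits, sortedness makes the head of `R`, if any, larger
than `x` too, so `x` heads both results. -/
theorem rowInsert_sublist {R S : List ℕ+} (h : R.Sublist S) (hS : S.Pairwise (· ≤ ·)) (x : ℕ+) :
    (rowInsert x R).1.Sublist (rowInsert x S).1 := by
  induction h with
  | slnil => exact List.Sublist.refl _
  | @cons R S r h ih =>
    rw [List.pairwise_cons] at hS
    rcases lt_or_ge x r with hx | hx
    · rw [rowInsert_cons_of_lt hx]
      cases R with
      | nil => simp [rowInsert]
      | cons t R =>
        rw [rowInsert_cons_of_lt (hx.trans_le (hS.1 t (h.subset (by simp))))]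
        exact (List.sublist_of_cons_sublist h).cons_cons x
    · rw [rowInsert_cons_of_le hx]
      exact (ih hS.2).cons r
  | cons_cons r h ih =>
    rcases lt_or_ge x r with hx | hx
    · rw [rowInsert_cons_of_lt hx, rowInsert_cons_of_lt hx]
      exact h.cons_cons x
    · rw [rowInsert_cons_of_le hx, rowInsert_cons_of_le hx]
      exact (ih (List.pairwise_cons.1 hS).2).cons_cons r

theorem countP_le_rowInsert_of_le {a x : ℕ+} (hx : a ≤ x) (R : List ℕ+) :
    (rowInsert x R).1.countP (fun y => y ≤ a) =
      R.countP (fun y => y ≤ a) + if x = a then 1 else 0 := by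
  have hxa : x ≤ a ↔ x = a := ⟨fun h => h.antisymm hx, fun h => h.le⟩
  induction R with
  | nil => simp [rowInsert, List.countP_cons, hxa]
  | cons r R ih =>
    rcases lt_or_ge x r with h | h
    · simp [rowInsert_cons_of_lt h, List.countP_cons, hxa, not_le.2 (hx.trans_lt h)]
    · simp only [rowInsert_cons_of_le h, List.countP_cons, ih]
      omega

/-- A letter `x < a` bumps the leftmost entry above `x`; since `a` is present, that entry is at most
`a`, and the count is unchanged. -/
theorem countP_le_rowInsert_of_mem {a : ℕ+} {R : List ℕ+} (hR : R.Pairwise (· ≤ ·))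
    (ha : a ∈ R) (x : ℕ+) :
    (rowInsert x R).1.countP (fun y => y ≤ a) =
      R.countP (fun y => y ≤ a) + if x = a then 1 else 0 := by
  rcases le_or_gt a x with hx | hx
  · exact countP_le_rowInsert_of_le hx R
  induction R with
  | nil => simp at ha
  | cons r R ih =>
    rw [List.pairwise_cons] at hR
    have hra : r ≤ a := by
      rcases List.mem_cons.1 ha with rfl | h
      exacts [le_rfl, hR.1 a h]
    rcases lt_or_ge x r with h | h
    · simp [rowInsert_cons_of_lt h, hx.le, hx.ne, hra]
    · have haR : a ∈ R := by
        rcases List.mem_cons.1 ha with rfl | h'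
        · exact absurd hx (not_lt.2 h)
        · exact h'
      simp only [rowInsert_cons_of_le h, List.countP_cons, ih hR.2 haR]
      omega

theorem count_le_count_rowInsert_add_one (a x : ℕ+) (R : List ℕ+) :
    R.count a ≤ (rowInsert x R).1.count a + 1 := by
  induction R with
  | nil => simp
  | cons r R ih =>
    rcases lt_or_ge x r with h | h
    · simp only [rowInsert_cons_of_lt h, List.count_cons]
      split <;> omega
    · simp only [rowInsert_cons_of_le h, List.count_cons]
      omega

/-- Each `a` bumps one larger entry while there is one; truncated subtraction covers the remaining
case. -/
theorem countP_gt_rowInsert_self (a : ℕ+) (R : List ℕ+) :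
    (rowInsert a R).1.countP (fun y => a < y) = R.countP (fun y => a < y) - 1 := by
  induction R with
  | nil => simp [rowInsert]
  | cons r R ih =>
    rcases lt_or_ge a r with h | h
    · simp [rowInsert_cons_of_lt h, h]
    · simpa [rowInsert_cons_of_le h, not_lt.2 h] using ih

/-! ### Insertion of a word into a single row -/

/-- The row obtained from `R` by inserting the letters of `w`, forgetting the bumped letters. -/
def rowInsertWord (R : List ℕ+) (w : Word) : List ℕ+ :=
  w.foldl (fun R x => (rowInsert x R).1) R

@[simp] theorem rowInsertWord_nil (R : List ℕ+) : rowInsertWord R [] = R := rfl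

@[simp] theorem rowInsertWord_cons (R : List ℕ+) (x : ℕ+) (w : Word) :
    rowInsertWord R (x :: w) = rowInsertWord (rowInsert x R).1 w := rfl

theorem rowInsertWord_append (R : List ℕ+) (v w : Word) :
    rowInsertWord R (v ++ w) = rowInsertWord (rowInsertWord R v) w :=
  List.foldl_append

theorem pairwise_rowInsertWord {R : List ℕ+} (hR : R.Pairwise (· ≤ ·)) (w : Word) :
    (rowInsertWord R w).Pairwise (· ≤ ·) := by
  induction w generalizing R with
  | nil => exact hR
  | cons x w ih => exact ih (pairwise_rowInsert hR x)

theorem rowInsertWord_sublist {R S : List ℕ+} (h : R.Sublist S) (hS : S.Pairwise (· ≤ ·))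
    (w : Word) : (rowInsertWord R w).Sublist (rowInsertWord S w) := by
  induction w generalizing R S with
  | nil => exact h
  | cons x w ih => exact ih (rowInsert_sublist h hS x) (pairwise_rowInsert hS x)

theorem rowInsertWord_acb {R : List ℕ+} (hR : R.Pairwise (· ≤ ·)) {a b c : ℕ+} (hab : a ≤ b)
    (hbc : b < c) : rowInsertWord R [a, c, b] = rowInsertWord R [c, a, b] := by
  have hac := hab.trans_lt hbc
  simp only [rowInsertWord_cons, rowInsertWord_nil]
  induction R with
  | nil => simp [rowInsert, hac, not_lt.2 hab, not_lt.2 hac.le, hbc]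
  | cons r R ih =>
    rw [List.pairwise_cons] at hR
    rcases lt_or_ge a r with h | h
    · rcases lt_or_ge c r with h' | h'
      · rw [rowInsert_cons_of_lt h, rowInsert_cons_of_lt h', rowInsert_cons_of_le hac.le,
          rowInsert_cons_of_lt hac, rowInsert_cons_of_le hab, rowInsert_cons_of_le hab]
        cases R with
        -- After `a` and `c` only the entry following `r` matters; sortedness places it above `c`.
        | nil => simp [rowInsert, hbc]
        | cons s R =>
          have hs : c < s := h'.trans_le (hR.1 s (by simp))
          simp [rowInsert_cons_of_lt hs, rowInsert_cons_of_lt hbc,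
            rowInsert_cons_of_lt (hbc.trans hs)]
      · simp [rowInsert_cons_of_lt h, rowInsert_cons_of_le h', rowInsert_cons_of_le hac.le]
    · simp [rowInsert_cons_of_le h, rowInsert_cons_of_le (h.trans hab),
        rowInsert_cons_of_le (h.trans hac.le), ih hR.2]

theorem rowInsertWord_bac (R : List ℕ+) {a b c : ℕ+} (hab : a < b)
    (hbc : b ≤ c) : rowInsertWord R [b, a, c] = rowInsertWord R [b, c, a] := by
  have hac := hab.trans_le hbc
  simp only [rowInsertWord_cons, rowInsertWord_nil]
  induction R with
  | nil => simp [rowInsert, hab, not_lt.2 hbc, not_lt.2 hac.le]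
  | cons r R ih =>
    rcases lt_or_ge b r with h | h
    · simp [rowInsert_cons_of_lt h, rowInsert_cons_of_lt hab, rowInsert_cons_of_le hac.le,
        rowInsert_cons_of_le hbc]
    · rcases lt_or_ge a r with h' | h'
      · simp [rowInsert_cons_of_le h, rowInsert_cons_of_lt h', rowInsert_cons_of_le hac.le,
          rowInsert_cons_of_le (h.trans hbc)]
      · simp [rowInsert_cons_of_le h, rowInsert_cons_of_le h', rowInsert_cons_of_le (h.trans hbc),
          ih]

/-- The first row of the insertion tableau is invariant under Knuth equivalence. -/
theorem KnuthEquiv.rowInsertWord_eq {v w : Word} (h : KnuthEquiv v w) {R : List ℕ+}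
    (hR : R.Pairwise (· ≤ ·)) : rowInsertWord R v = rowInsertWord R w := by
  induction h with
  | rel v w h =>
    cases h with
    | acb x y a b c hab hbc =>
      simp only [rowInsertWord_append]
      rw [rowInsertWord_acb (pairwise_rowInsertWord hR x) hab hbc]
    | bac x y a b c hab hbc =>
      simp only [rowInsertWord_append]
      rw [rowInsertWord_bac _ hab hbc]
  | refl => rfl
  | symm _ _ _ ih => exact ih.symm
  | trans _ _ _ _ _ ih ih' => exact ih.trans ih'

/-- Each insertion destroys at most one `a`, so the length bound keeps an `a` in the row throughout.
-/
theorem countP_le_rowInsertWord {a : ℕ+} {R : List ℕ+} (hR : R.Pairwise (· ≤ ·)) {w : Word}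
    (hw : w.length < R.count a) :
    (rowInsertWord R w).countP (fun y => y ≤ a) =
      R.countP (fun y => y ≤ a) + w.count a := by
  induction w generalizing R with
  | nil => simp
  | cons x w ih =>
    have h1 := count_le_count_rowInsert_add_one a x R
    rw [List.length_cons] at hw
    have ha : a ∈ R := List.count_pos_iff.1 (by omega)
    rw [rowInsertWord_cons, ih (pairwise_rowInsert hR x) (by omega),
      countP_le_rowInsert_of_mem hR ha, List.count_cons]
    simp only [beq_iff_eq]
    omega

theorem countP_le_rowInsertWord_replicate (a : ℕ+) (R : List ℕ+) (n : ℕ) :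
    (rowInsertWord R (List.replicate n a)).countP (fun y => y ≤ a) =
      R.countP (fun y => y ≤ a) + n := by
  induction n generalizing R with
  | zero => simp
  | succ n ih =>
    rw [List.replicate_succ, rowInsertWord_cons, ih, countP_le_rowInsert_of_le le_rfl, if_pos rfl]
    omega

theorem countP_gt_rowInsertWord_replicate (a : ℕ+) (R : List ℕ+) (n : ℕ) :
    (rowInsertWord R (List.replicate n a)).countP (fun y => a < y) =
      R.countP (fun y => a < y) - n := by
  induction n generalizing R with
  | zero => simp
  | succ n ih =>
    rw [List.replicate_succ, rowInsertWord_cons, ih, countP_gt_rowInsert_self]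
    omega

theorem length_rowInsert_le (x : ℕ+) (R : List ℕ+) :
    (rowInsert x R).1.length ≤ R.length + 1 := by
  induction R with
  | nil => simp [rowInsert]
  | cons r R ih =>
    rcases lt_or_ge x r with h | h
    · simp [rowInsert_cons_of_lt h]
    · simpa [rowInsert_cons_of_le h] using ih

theorem length_rowInsertWord_le (R : List ℕ+) (w : Word) :
    (rowInsertWord R w).length ≤ R.length + w.length := by
  induction w generalizing R with
  | nil => simp
  | cons x w ih =>
    have := ih (rowInsert x R).1
    have := length_rowInsert_le x R
    simp only [rowInsertWord_cons, List.length_cons]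
    omega

theorem rowInsertWord_nil_replicate (a : ℕ+) (n : ℕ) :
    rowInsertWord [] (List.replicate n a) = List.replicate n a := by
  have h (m : ℕ) : (rowInsert a (List.replicate m a)).1 = List.replicate (m + 1) a := by
    induction m with
    | zero => rfl
    | succ m ih => rw [List.replicate_succ, rowInsert_cons_of_le le_rfl, ih]; rfl
  induction n with
  | zero => rfl
  | succ n ih =>
    conv_lhs => rw [List.replicate_succ', rowInsertWord_append, ih]
    exact h n

/-! ### Semistandard tableaux -/

/-- `Above R S`: the row `S` fits below the row `R`, with strictly increasing columns. -/
def Above : List ℕ+ → List ℕ+ → Prop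
  | _, [] => True
  | [], _ :: _ => False
  | r :: R, s :: S => r < s ∧ Above R S

@[simp] theorem above_nil (R : List ℕ+) : Above R [] := by
  cases R <;> trivial

theorem Above.tail {R S : List ℕ+} (h : Above R S) : Above R.tail S.tail := by
  cases S with
  | nil => simp
  | cons s S =>
    cases R with
    | nil => exact h.elim
    | cons r R => exact h.2

theorem Above.getElem? {R S : List ℕ+} (h : Above R S) {j : ℕ} {s : ℕ+} (hs : S[j]? = some s) :
    ∃ r < s, R[j]? = some r := by
  induction S generalizing R j with
  | nil => simp at hs
  | cons t S ih =>
    cases R with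
    | nil => exact h.elim
    | cons r R =>
      cases j with
      | zero =>
        simp only [List.getElem?_cons_zero, Option.some.injEq] at hs
        exact ⟨r, hs ▸ h.1, rfl⟩
      | succ j => simpa using ih h.2 (by simpa using hs)

theorem Above.countP_le {R S : List ℕ+} (h : Above R S) (a : ℕ+) :
    S.countP (fun x => x ≤ a) ≤ R.countP (fun x => x < a) := by
  induction S generalizing R with
  | nil => simp
  | cons s S ih =>
    cases R with
    | nil => exact h.elim
    | cons r R =>
      have h1 := ih h.2
      simp only [List.countP_cons, decide_eq_true_eq]
      by_cases hs : s ≤ a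
      · rw [if_pos hs, if_pos (h.1.trans_le hs)]
        omega
      · rw [if_neg hs]
        omega

theorem Above.rowInsert_left {R S : List ℕ+} (h : Above R S) (x : ℕ+) :
    Above (rowInsert x R).1 S := by
  induction R generalizing S with
  | nil =>
    cases S with
    | nil => simp
    | cons s S => exact h.elim
  | cons r R ih =>
    cases S with
    | nil => simp
    | cons s S =>
      rcases lt_or_ge x r with hx | hx
      · rw [rowInsert_cons_of_lt hx]
        exact ⟨hx.trans h.1, h.2⟩
      · rw [rowInsert_cons_of_le hx]
        exact ⟨h.1, ih h.2⟩

/-- The entry of `S` below the old place of `y`, if any, exceeds `y`, so `y` lands in that column or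
further left, under an entry `≤ x < y`. -/
theorem Above.rowInsert_bumped {R S : List ℕ+} (h : Above R S) {x y : ℕ+}
    (hy : (rowInsert x R).2 = some y) : Above (rowInsert x R).1 (rowInsert y S).1 := by
  induction R generalizing S with
  | nil => simp [rowInsert] at hy
  | cons r R ih =>
    rcases lt_or_ge x r with hx | hx
    · rw [rowInsert_cons_of_lt hx] at hy ⊢
      obtain rfl : r = y := by simpa using hy
      cases S with
      | nil => exact ⟨hx, above_nil _⟩
      | cons s S =>
        rw [rowInsert_cons_of_lt h.1]
        exact ⟨hx, h.2⟩
    · rw [rowInsert_cons_of_le hx] at hy ⊢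
      have hry : r < y := hx.trans_lt (lt_of_rowInsert_eq_some hy)
      cases S with
      | nil => exact ⟨hry, above_nil _⟩
      | cons s S =>
        rcases lt_or_ge y s with hs | hs
        · rw [rowInsert_cons_of_lt hs]
          exact ⟨hry, h.2.rowInsert_left x⟩
        · rw [rowInsert_cons_of_le hs]
          exact ⟨h.1, ih h.2 hy⟩

@[simp] theorem row_cons_zero (R : List ℕ+) (T : Tableau) : row (R :: T) 0 = R := rfl

@[simp] theorem row_cons_succ (R : List ℕ+) (T : Tableau) (i : ℕ) :
    row (R :: T) (i + 1) = row T i := rfl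

@[simp] theorem row_nil (i : ℕ) : row [] i = [] := rfl

/-- Semistandard tableaux, where empty rows are permitted at the bottom. -/
def IsSemistandard : Tableau → Prop
  | [] => True
  | R :: T => R.Pairwise (· ≤ ·) ∧ Above R (row T 0) ∧ IsSemistandard T

theorem row_tableauInsert_zero (x : ℕ+) (T : Tableau) :
    row (tableauInsert x T) 0 = (rowInsert x (row T 0)).1 := by
  cases T with
  | nil => rfl
  | cons R T =>
    rw [tableauInsert]
    split <;> rfl

theorem IsSemistandard.tableauInsert {T : Tableau} (hT : IsSemistandard T) (x : ℕ+) :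
    IsSemistandard (tableauInsert x T) := by
  induction T generalizing x with
  | nil => exact ⟨List.pairwise_singleton _ _, above_nil _, trivial⟩
  | cons R T ih =>
    obtain ⟨hR, hRT, hT⟩ := hT
    rw [Plactic.tableauInsert]
    split
    · exact ⟨pairwise_rowInsert hR x, hRT.rowInsert_left x, hT⟩
    · next y hy =>
      refine ⟨pairwise_rowInsert hR x, ?_, ih hT y⟩
      rw [row_tableauInsert_zero]
      exact hRT.rowInsert_bumped hy

/-- The row reading word of a tableau: the rows are read from bottom to top. -/
def rowWord (T : Tableau) : Word := T.reverse.flatten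

@[simp] theorem rowWord_nil : rowWord [] = [] := rfl

@[simp] theorem rowWord_cons (R : List ℕ+) (T : Tableau) : rowWord (R :: T) = rowWord T ++ R := by
  simp [rowWord]

theorem IsSemistandard.knuthEquiv_tableauInsert {T : Tableau} (hT : IsSemistandard T) (x : ℕ+) :
    KnuthEquiv (rowWord T ++ [x]) (rowWord (Plactic.tableauInsert x T)) := by
  induction T generalizing x with
  | nil => exact KnuthEquiv.refl _
  | cons R T ih =>
    obtain ⟨hR, -, hT⟩ := hT
    have h := (knuthEquiv_rowInsert hR x).append_left (rowWord T)
    rw [Plactic.tableauInsert]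
    split
    · next hy =>
      rw [hy] at h
      simpa using h
    · next y hy =>
      rw [hy] at h
      simpa using h.trans (by simpa using (ih hT y).append_right (rowInsert x R).1)

theorem insertionTableau_append_singleton (w : Word) (x : ℕ+) :
    insertionTableau (w ++ [x]) = tableauInsert x (insertionTableau w) := by
  simp [insertionTableau]

theorem isSemistandard_insertionTableau (w : Word) : IsSemistandard (insertionTableau w) := by
  induction w using List.reverseRecOn with
  | nil => trivial
  | append_singleton w x ih =>
    rw [insertionTableau_append_singleton]
    exact ih.tableauInsert x

/-- A word is Knuth-equivalent to the row reading word of its insertion tableau. -/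
theorem knuthEquiv_rowWord_insertionTableau (w : Word) :
    KnuthEquiv w (rowWord (insertionTableau w)) := by
  induction w using List.reverseRecOn with
  | nil => exact KnuthEquiv.refl _
  | append_singleton w x ih =>
    rw [insertionTableau_append_singleton]
    exact (ih.append_right [x]).trans
      ((isSemistandard_insertionTableau w).knuthEquiv_tableauInsert x)

theorem row_insertionTableau_zero (w : Word) :
    row (insertionTableau w) 0 = rowInsertWord [] w := by
  induction w using List.reverseRecOn with
  | nil => rfl
  | append_singleton w x ih =>
    rw [insertionTableau_append_singleton, row_tableauInsert_zero, ih, rowInsertWord_append]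
    rfl

/-! ### Columns and the row condition -/

theorem mem_column {T : Tableau} {j : ℕ} {a : ℕ+} :
    a ∈ column T j ↔ ∃ R ∈ T, R[j]? = some a := by
  simp [column]

theorem IsSemistandard.exists_le_row_zero {T : Tableau} (hT : IsSemistandard T) {j : ℕ} {s : ℕ+}
    (hs : s ∈ column T j) : ∃ r ≤ s, (row T 0)[j]? = some r := by
  induction T generalizing s with
  | nil => simp [column] at hs
  | cons R T ih =>
    rw [mem_column] at hs
    obtain ⟨S, hS, hSs⟩ := hs
    rcases List.mem_cons.1 hS with rfl | hS
    · exact ⟨s, le_rfl, hSs⟩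
    · obtain ⟨t, hts, ht⟩ := ih hT.2.2 (mem_column.2 ⟨S, hS, hSs⟩)
      obtain ⟨r, hrt, hr⟩ := hT.2.1.getElem? ht
      exact ⟨r, hrt.le.trans hts, hr⟩

theorem IsSemistandard.pairwise_column {T : Tableau} (hT : IsSemistandard T) (j : ℕ) :
    (column T j).Pairwise (· < ·) := by
  induction T with
  | nil => simp [column]
  | cons R T ih =>
    have h := ih hT.2.2
    cases hr : R[j]? with
    | none => simpa [column, hr] using h
    | some r =>
      have hc : column (R :: T) j = r :: column T j := by simp [column, hr]
      rw [hc, List.pairwise_cons]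
      refine ⟨fun s hs => ?_, h⟩
      obtain ⟨t, hts, ht⟩ := hT.2.2.exists_le_row_zero hs
      obtain ⟨r', hrt, hr'⟩ := hT.2.1.getElem? ht
      obtain rfl : r = r' := by simpa [hr] using hr'
      exact hrt.trans_le hts

/-- In a sorted row the entries satisfying a downward closed predicate form a prefix, so counts
translate into column indices. -/
theorem lt_countP_iff_of_pairwise {R : List ℕ+} (hR : R.Pairwise (· ≤ ·)) (p : ℕ+ → Prop)
    [DecidablePred p] (hp : ∀ x y, x ≤ y → p y → p x) (j : ℕ) :
    j < R.countP (fun x => p x) ↔ ∃ r, R[j]? = some r ∧ p r := by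
  induction R generalizing j with
  | nil => simp
  | cons r R ih =>
    rw [List.pairwise_cons] at hR
    by_cases h : p r
    · cases j with
      | zero => simp [h]
      | succ j => simpa [h] using ih hR.2 j
    · have h0 : ∀ s ∈ r :: R, ¬ p s := by
        intro s hs hps
        rcases List.mem_cons.1 hs with rfl | hs
        exacts [h hps, h (hp _ _ (hR.1 s hs) hps)]
      have h1 : (r :: R).countP (fun x => p x) = 0 := by
        rw [List.countP_eq_zero]
        simpa using h0
      rw [h1]
      refine iff_of_false (by simp) ?_
      rintro ⟨s, hs, hps⟩
      exact h0 s (List.mem_of_getElem? hs) hps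

theorem lt_countP_le_iff {R : List ℕ+} (hR : R.Pairwise (· ≤ ·)) {a : ℕ+} {j : ℕ} :
    j < R.countP (fun x => x ≤ a) ↔ ∃ r, R[j]? = some r ∧ r ≤ a :=
  lt_countP_iff_of_pairwise hR (fun x => x ≤ a) (fun _ _ h h' => h.trans h') j

theorem lt_countP_lt_iff {R : List ℕ+} (hR : R.Pairwise (· ≤ ·)) {a : ℕ+} {j : ℕ} :
    j < R.countP (fun x => x < a) ↔ ∃ r, R[j]? = some r ∧ r < a :=
  lt_countP_iff_of_pairwise hR (fun x => x < a) (fun _ _ h h' => h.trans_lt h') j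

theorem IsSemistandard.pairwise_row_zero {T : Tableau} (hT : IsSemistandard T) :
    (row T 0).Pairwise (· ≤ ·) := by
  cases T with
  | nil => simp
  | cons R T => exact hT.1

theorem IsSemistandard.mem_column_of_countP_eq {T : Tableau} (hT : IsSemistandard T) {a : ℕ+}
    (h : ∀ i, (row T i).countP (fun x => x < a) = (row T (i + 1)).countP (fun x => x ≤ a))
    {j : ℕ} (hj : j < (row T 0).countP (fun x => x ≤ a)) : a ∈ column T j := by
  induction T with
  | nil => simp at hj
  | cons R T ih =>
    obtain ⟨r, hr, hra⟩ := (lt_countP_le_iff hT.1).1 hj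
    rcases hra.eq_or_lt with rfl | hra
    · exact mem_column.2 ⟨R, by simp, hr⟩
    · have h0 : R.countP (fun x => x < a) = (row T 0).countP (fun x => x ≤ a) := h 0
      obtain ⟨S, hS, hSa⟩ := mem_column.1 <| ih hT.2.2 (fun i => h (i + 1))
        (h0 ▸ (lt_countP_lt_iff hT.1).2 ⟨r, hr, hra⟩)
      exact mem_column.2 ⟨S, List.mem_cons_of_mem _ hS, hSa⟩

/-- Restricting to columns with top entry `≤ a` makes the hypothesis pass to the tableau without its
first row. -/
theorem IsSemistandard.countP_eq_of_mem_column {T : Tableau} (hT : IsSemistandard T) {a : ℕ+}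
    (h : ∀ j < (row T 0).countP (fun x => x ≤ a), a ∈ column T j) (i : ℕ) :
    (row T i).countP (fun x => x < a) = (row T (i + 1)).countP (fun x => x ≤ a) := by
  induction T generalizing i with
  | nil => simp
  | cons R T ih =>
    have key : ∀ j < R.countP (fun x => x < a), a ∈ column T j := by
      intro j hj
      obtain ⟨r, hr, hra⟩ := (lt_countP_lt_iff hT.1).1 hj
      obtain ⟨S, hS, hSa⟩ := mem_column.1 (h j ((lt_countP_le_iff hT.1).2 ⟨r, hr, hra.le⟩))
      rcases List.mem_cons.1 hS with rfl | hS
      · rw [hr, Option.some.injEq] at hSa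
        exact absurd hSa hra.ne
      · exact mem_column.2 ⟨S, hS, hSa⟩
    have hle := hT.2.1.countP_le a
    cases i with
    | zero =>
      -- Were the inequality strict, the first column not counted in the next row would contain `a`,
      -- so its top entry there would be `≤ a` and counted after all.
      refine le_antisymm (le_of_not_gt fun hlt => ?_) hle
      obtain ⟨r, hra, hr⟩ := hT.2.2.exists_le_row_zero (key _ hlt)
      exact lt_irrefl _ ((lt_countP_le_iff hT.2.2.pairwise_row_zero).2 ⟨r, hr, hra⟩)
    | succ i => exact ih hT.2.2 (fun j hj => key j (hj.trans_le hle)) i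

theorem IsSemistandard.rowCondition_iff_columnCondition {T : Tableau} (hT : IsSemistandard T)
    (a : ℕ+) : RowCondition a T ↔ ColumnCondition a T := by
  constructor
  · rintro ⟨h0, h⟩ j hj
    refine hT.mem_column_of_countP_eq h ((lt_countP_le_iff hT.pairwise_row_zero).2 ?_)
    exact ⟨_, List.getElem?_eq_getElem hj, h0 _ (List.getElem_mem hj)⟩
  · intro h
    refine ⟨fun x hx => ?_, hT.countP_eq_of_mem_column fun j hj => h j ?_⟩
    · obtain ⟨j, hj, rfl⟩ := List.getElem_of_mem hx
      obtain ⟨r, hra, hr⟩ := hT.exists_le_row_zero (h j hj)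
      rw [List.getElem?_eq_getElem hj, Option.some.injEq] at hr
      exact hr ▸ hra
    · exact hj.trans_le List.countP_le_length

theorem countP_le_eq_countP_lt_add_count (a : ℕ+) (R : List ℕ+) :
    R.countP (fun x => x ≤ a) = R.countP (fun x => x < a) + R.count a := by
  induction R with
  | nil => rfl
  | cons r R ih =>
    simp only [List.countP_cons, List.count_cons, ih, decide_eq_true_eq, beq_iff_eq]
    rcases lt_trichotomy r a with h | rfl | h
    · simp [h, h.le, h.ne]; omega
    · simp; omega
    · simp [h.not_gt, h.not_ge, h.ne']

/-- Telescoping: `#{R_i ≤ a} = #{R_i < a} + #{R_i = a}`, and `#{R_i < a} ≥ #{R_{i+1} ≤ a}`. -/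
theorem IsSemistandard.count_le {T : Tableau} (hT : IsSemistandard T) (a : ℕ+) :
    (rowWord T).count a ≤ (row T 0).countP (fun x => x ≤ a) := by
  induction T with
  | nil => simp
  | cons R T ih =>
    have h1 := ih hT.2.2
    have h2 := hT.2.1.countP_le a
    rw [rowWord_cons, List.count_append, row_cons_zero, countP_le_eq_countP_lt_add_count]
    omega

/-- If the first row has as many entries at most `a` as the tableau has entries `a`, then all the
interlacing inequalities between consecutive rows are equalities. -/
theorem IsSemistandard.countP_eq_of_count_eq {T : Tableau} (hT : IsSemistandard T) {a : ℕ+}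
    (h : (row T 0).countP (fun x => x ≤ a) = (rowWord T).count a) (i : ℕ) :
    (row T i).countP (fun x => x < a) = (row T (i + 1)).countP (fun x => x ≤ a) := by
  induction T generalizing i with
  | nil => simp
  | cons R T ih =>
    have h1 := hT.2.2.count_le a
    have h2 := hT.2.1.countP_le a
    rw [rowWord_cons, List.count_append, row_cons_zero, countP_le_eq_countP_lt_add_count] at h
    cases i with
    | zero =>
      rw [row_cons_zero, row_cons_succ]
      omega
    | succ i => exact ih hT.2.2 (by omega) i

theorem rowCondition_of_mem_centralizer {a : ℕ+} {k : ℕ} (hk : 0 < k) {w : Word}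
    (hw : w ∈ centralizer (List.replicate k a)) : RowCondition a (insertionTableau w) := by
  obtain ⟨n, hn, hcomm⟩ : ∃ n, w.length < n ∧ w ∈ centralizer (List.replicate n a) :=
    ⟨(w.length + 1) * k, by nlinarith, mem_centralizer_replicate_mul hw _⟩
  have hrow := KnuthEquiv.rowInsertWord_eq hcomm (R := []) List.Pairwise.nil
  rw [rowInsertWord_append, rowInsertWord_append, rowInsertWord_nil_replicate] at hrow
  have hsorted : (List.replicate n a).Pairwise (· ≤ ·) := by simp [List.pairwise_replicate]
  have hT := isSemistandard_insertionTableau w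
  refine ⟨fun x hx => ?_, hT.countP_eq_of_count_eq ?_⟩
  -- `x` survives in the first row of `a^n w`, which is that of `w a^n`; there all entries above `a`
  -- are gone because `n` exceeds the length of `R_1`.
  · rw [row_insertionTableau_zero] at hx
    have hx' := (rowInsertWord_sublist (List.nil_sublist _) hsorted w).subset hx
    have h0 := countP_gt_rowInsertWord_replicate a (rowInsertWord [] w) n
    have hlen := length_rowInsertWord_le [] w
    have hcount := List.countP_le_length (p := fun y => decide (a < y)) (l := rowInsertWord [] w)
    rw [← hrow, Nat.sub_eq_zero_of_le (by simp at hlen; omega), List.countP_eq_zero] at h0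
    simpa using h0 x hx'
  · have h1 := countP_le_rowInsertWord (a := a) hsorted (w := w) (by simpa using hn)
    rw [hrow, countP_le_rowInsertWord_replicate] at h1
    have h2 : (List.replicate n a).countP (fun y => y ≤ a) = n := by
      simp [List.countP_replicate]
    rw [row_insertionTableau_zero, ← (knuthEquiv_rowWord_insertionTableau w).perm.count_eq a]
    omega

/-! ### Splitting off the first column -/

/-- The first letters of rows, read from bottom to top, can be moved to the front. -/
theorem knuthEquiv_flatten {L : List (List ℕ+)} (hL : ∀ R ∈ L, R.Pairwise (· ≤ ·))
    (hc : (L.filterMap List.head?).Pairwise (· > ·)) :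
    KnuthEquiv L.flatten (L.filterMap List.head? ++ (L.map List.tail).flatten) := by
  induction L with
  | nil => exact KnuthEquiv.refl _
  | cons R L ih =>
    cases R with
    | nil =>
      simpa [List.filterMap_cons] using
        ih (fun R hR => hL R (by simp [hR])) (by simpa [List.filterMap_cons] using hc)
    | cons c R =>
      simp only [List.filterMap_cons, List.head?_cons] at hc ⊢
      have h1 := (ih (fun R hR => hL R (by simp [hR])) (List.pairwise_cons.1 hc).2).append_left
        (c :: R)
      -- The heads of the later rows are smaller than `c`, so they pass left through `R`.
      have h2 := (KnuthEquiv.cons_append_decreasing (hL (c :: R) (by simp)) hc).append_right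
        (L.map List.tail).flatten
      simpa using h1.trans (by simpa using h2)

theorem IsSemistandard.pairwise_of_mem {T : Tableau} (hT : IsSemistandard T) :
    ∀ R ∈ T, R.Pairwise (· ≤ ·) := by
  induction T with
  | nil => simp
  | cons R T ih =>
    intro S hS
    rcases List.mem_cons.1 hS with rfl | hS
    exacts [hT.1, ih hT.2.2 S hS]

theorem IsSemistandard.knuthEquiv_rowWord {T : Tableau} (hT : IsSemistandard T) :
    KnuthEquiv (rowWord T) ((column T 0).reverse ++ rowWord (T.map List.tail)) := by
  have hc : column T 0 = T.filterMap List.head? := by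
    simp only [column, List.head?_eq_getElem?]
  have h := knuthEquiv_flatten (L := T.reverse)
    (fun R hR => hT.pairwise_of_mem R (List.mem_reverse.1 hR))
    (by simpa [List.filterMap_reverse, List.pairwise_reverse, hc] using hT.pairwise_column 0)
  rw [hc]
  simpa [rowWord, List.filterMap_reverse, List.map_reverse] using h

theorem row_map_tail_zero (T : Tableau) : row (T.map List.tail) 0 = (row T 0).tail := by
  cases T <;> rfl

theorem IsSemistandard.map_tail {T : Tableau} (hT : IsSemistandard T) :
    IsSemistandard (T.map List.tail) := by
  induction T with
  | nil => trivial
  | cons R T ih =>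
    refine ⟨hT.1.sublist (List.tail_sublist R), ?_, ih hT.2.2⟩
    rw [row_map_tail_zero]
    exact hT.2.1.tail

theorem column_map_tail (T : Tableau) (j : ℕ) :
    column (T.map List.tail) j = column T (j + 1) := by
  simp [column, List.filterMap_map]

/-- Removing columns leaves empty rows behind, so an exhausted tableau need not be the empty list.
-/
theorem IsSemistandard.rowWord_eq_nil {T : Tableau} (hT : IsSemistandard T)
    (h : row T 0 = []) : rowWord T = [] := by
  induction T with
  | nil => rfl
  | cons R T ih =>
    obtain rfl : R = [] := h
    rw [rowWord_cons, List.append_nil]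
    refine ih hT.2.2 ?_
    have hA := hT.2.1
    cases hr : row T 0 with
    | nil => rfl
    | cons s S =>
      rw [hr] at hA
      exact hA.elim

theorem IsSemistandard.rowWord_mem_centralizer {T : Tableau} (hT : IsSemistandard T) {a : ℕ+}
    (h : ColumnCondition a T) : rowWord T ∈ centralizer [a] := by
  -- Induction on the number of columns.
  induction hn : (row T 0).length generalizing T with
  | zero =>
    rw [hT.rowWord_eq_nil (List.length_eq_zero_iff.1 hn)]
    exact KnuthEquiv.refl _
  | succ n ih =>
    have h1 : KnuthEquiv (a :: rowWord (T.map List.tail)) (rowWord (T.map List.tail) ++ [a]) := by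
      refine ih hT.map_tail (fun j hj => ?_) (by simp [row_map_tail_zero, hn])
      rw [row_map_tail_zero, List.length_tail] at hj
      rw [column_map_tail]
      exact h (j + 1) (by omega)
    have h2 : KnuthEquiv (a :: (column T 0).reverse) ((column T 0).reverse ++ [a]) :=
      KnuthEquiv.commute_column (by simpa [List.pairwise_reverse] using hT.pairwise_column 0)
        (List.mem_reverse.2 (h 0 (by omega)))
    have h3 := hT.knuthEquiv_rowWord
    calc KnuthEquiv (a :: rowWord T)
          (a :: ((column T 0).reverse ++ rowWord (T.map List.tail))) := h3.append_left [a]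
      KnuthEquiv _ ((column T 0).reverse ++ a :: rowWord (T.map List.tail)) := by
          simpa using h2.append_right (rowWord (T.map List.tail))
      KnuthEquiv _ ((column T 0).reverse ++ rowWord (T.map List.tail) ++ [a]) := by
          simpa using h1.append_left (column T 0).reverse
      KnuthEquiv _ (rowWord T ++ [a]) := h3.symm.append_right [a]

theorem mem_centralizer_of_columnCondition {a : ℕ+} {w : Word}
    (h : ColumnCondition a (insertionTableau w)) (k : ℕ) :
    w ∈ centralizer (List.replicate k a) := by
  have h1 : KnuthEquiv ([a] ++ rowWord (insertionTableau w))
      (rowWord (insertionTableau w) ++ [a]) :=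
    (isSemistandard_insertionTableau w).rowWord_mem_centralizer h
  have h2 := knuthEquiv_rowWord_insertionTableau w
  have h3 : w ∈ centralizer (List.replicate 1 a) :=
    ((h2.append_left [a]).trans h1).trans (h2.symm.append_right [a])
  simpa using mem_centralizer_replicate_mul h3 k

theorem mem_centralizer_replicate_iff (a : ℕ+) {k : ℕ} (hk : 0 < k) (w : Word) :
    w ∈ centralizer (List.replicate k a) ↔ RowCondition a (insertionTableau w) :=
  ⟨rowCondition_of_mem_centralizer hk, fun h => mem_centralizer_of_columnCondition
    (((isSemistandard_insertionTableau w).rowCondition_iff_columnCondition a).1 h) k⟩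

end Plactic

theorem theoremC (a : ℕ+) (k : ℕ) (hk : 0 < k) :
    Plactic.centralizer (List.replicate k a) = Plactic.centralizer [a] ∧
    Plactic.centralizer (List.replicate k a) =
      {w : Plactic.Word | Plactic.RowCondition a (Plactic.insertionTableau w)} ∧
    Plactic.centralizer (List.replicate k a) =
      {w : Plactic.Word | Plactic.ColumnCondition a (Plactic.insertionTableau w)} := by
  have h {k : ℕ} (hk : 0 < k) : Plactic.centralizer (List.replicate k a) =
      {w : Plactic.Word | Plactic.RowCondition a (Plactic.insertionTableau w)} :=
    Set.ext (Plactic.mem_centralizer_replicate_iff a hk)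
  refine ⟨(h hk).trans (h one_pos).symm, h hk, (h hk).trans (Set.ext fun w => ?_)⟩
  exact (Plactic.isSemistandard_insertionTableau w).rowCondition_iff_columnCondition a
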